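/- Let $H$ be a closed densely defined operator on a complex Banach space $\mathcal B$ with spectrum $\sigma(H)\subseteq[0,\infty)$, and suppose that there are constants $c$ and $\alpha\ge 0$ such that $$\|(z-H)^{-1}\|\le c\,|\operatorname{Im} z|^{-1}\left(\frac{\langle z\rangle}{|\operatorname{Im} z|}\right)^{\alpha}\qquad\text{for all } z\in\mathbb C\setminus\mathbb R,\qquad \langle z\rangle:=(1+|z|^2)^{1/2}.$$ For a smooth compactly supported $f:\mathbb R\to\mathbb C$, an integer $n>\alpha$ and a smooth function $\psi:\mathbb R\to\mathbb C$ with $\psi(s)=1$ for $|s|\le1$ and $\psi(s)=0$ for $|s|\ge2$, put $$\tilde f(x,y):=\left(\sum_{r=0}^n f^{(r)}(x)\frac{(iy)^r}{r!}\right)\psi\!\left(\frac{y}{\langle x\rangle}\right),\qquad \frac{\partial\tilde f}{\partial\bar z}:=\frac12\left(\frac{\partial\tilde f}{\partial x}+i\frac{\partial\tilde f}{\partial y}\right),$$ $$f(H):=-\frac1\pi\iint_{\mathbb C}\frac{\partial\tilde f}{\partial\bar z}\,(z-H)^{-1}\,dx\,dy .$$ If $f:\mathbb R\to\mathbb C$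 is smooth with $\operatorname{supp}(f)\subseteq[-a,0]$ for some real $a$ (in particular if $\operatorname{supp}(f)=[-a,0]$), then for every such $n$ and $\psi$ the integral defining $f(H)$ converges absolutely in operator norm, and $f(H)=0$. -/

import Mathlib

open MeasureTheory
open scoped ContDiff

namespace HelfferSjostrand

variable {B : Type*} [NormedAddCommGroup B] [NormedSpace ℂ B]

/-- `R` is a bounded everywhere defined two-sided inverse of `z - H : dom H → B`. -/
def IsResolventAt (H : B →ₗ.[ℂ] B) (z : ℂ) (R : B →L[ℂ] B) : Prop :=
  (∀ y : B, ∃ h : R y ∈ H.domain, z • R y - H ⟨R y, h⟩ = y) ∧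
    ∀ x : H.domain, R (z • (x : B) - H x) = x

/-- Such an inverse is unique. -/
theorem IsResolventAt.unique {H : B →ₗ.[ℂ] B} {z : ℂ} {R S : B →L[ℂ] B}
    (hR : IsResolventAt H z R) (hS : IsResolventAt H z S) : R = S := by
  ext y
  obtain ⟨h, e⟩ := hS.1 y
  have := hR.2 ⟨S y, h⟩
  simp only [e] at this
  exact this

/-- The resolvent set of the (possibly unbounded) operator `H`. -/
def resolventSet (H : B →ₗ.[ℂ] B) : Set ℂ := {z | ∃ R : B →L[ℂ] B, IsResolventAt H z R}

/-- The spectrum of the (possibly unbounded) operator `H`. -/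
def spectrum (H : B →ₗ.[ℂ] B) : Set ℂ := (resolventSet H)ᶜ

open Classical in
/-- The resolvent `(z - H)⁻¹` as a bounded operator on `B` for `z` in the resolvent set
(extended by `0` to the spectrum). -/
noncomputable def resolvent (H : B →ₗ.[ℂ] B) (z : ℂ) : B →L[ℂ] B :=
  if h : ∃ R : B →L[ℂ] B, IsResolventAt H z R then h.choose else 0

theorem isResolventAt_resolvent {H : B →ₗ.[ℂ] B} {z : ℂ} (hz : z ∈ resolventSet H) :
    IsResolventAt H z (resolvent H z) := by
  have h : ∃ R : B →L[ℂ] B, IsResolventAt H z R := hz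
  rw [resolvent, dif_pos h]
  exact h.choose_spec

/-- `⟨z⟩ = (1 + |z|²)^{1/2}`. -/
noncomputable def bracket (z : ℂ) : ℝ := √(1 + ‖z‖ ^ 2)

/-- The hypothesis on `H`: a closed densely defined operator with spectrum in `[0, ∞)` such that
`‖(z - H)⁻¹‖ ≤ c |Im z|⁻¹ (⟨z⟩ / |Im z|)^α` for all non-real `z`. -/
structure SemiBounded (H : B →ₗ.[ℂ] B) (c α : ℝ) : Prop where
  isClosed : H.IsClosed
  dense_domain : Dense (H.domain : Set B)
  spectrum_subset : spectrum H ⊆ (fun x : ℝ => (x : ℂ)) '' Set.Ici 0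
  norm_resolvent_le : ∀ z : ℂ, z.im ≠ 0 →
    ‖resolvent H z‖ ≤ c * |z.im|⁻¹ * (bracket z / |z.im|) ^ α

/-- A smooth cut-off function, equal to `1` for `|s| ≤ 1` and to `0` for `|s| ≥ 2`. -/
structure IsCutoff (ψ : ℝ → ℂ) : Prop where
  smooth : ContDiff ℝ ∞ ψ
  eq_one : ∀ s : ℝ, |s| ≤ 1 → ψ s = 1
  eq_zero : ∀ s : ℝ, 2 ≤ |s| → ψ s = 0

/-- The almost analytic extension
`f̃(x, y) = (∑_{r ≤ n} f⁽ʳ⁾(x) (iy)ʳ / r!) ψ(y / ⟨x⟩)`. -/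
noncomputable def almostAnalyticExt (n : ℕ) (ψ : ℝ → ℂ) (f : ℝ → ℂ) (x y : ℝ) : ℂ :=
  (∑ r ∈ Finset.range (n + 1),
    iteratedDeriv r f x * (Complex.I * (y : ℂ)) ^ r / (r.factorial : ℂ)) *
      ψ (y / bracket (x : ℂ))

/-- `∂F/∂z̄ = (∂F/∂x + i ∂F/∂y) / 2` at the point `z = x + iy`. -/
noncomputable def dbar (F : ℝ → ℝ → ℂ) (z : ℂ) : ℂ :=
  1 / 2 * (deriv (fun x : ℝ => F x z.im) z.re + Complex.I * deriv (fun y : ℝ => F z.re y) z.im)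

/-- The integrand `(∂f̃/∂z̄) (z - H)⁻¹` of the Helffer–Sjöstrand formula. -/
noncomputable def integrand (n : ℕ) (ψ : ℝ → ℂ) (f : ℝ → ℂ) (H : B →ₗ.[ℂ] B) (z : ℂ) :
    B →L[ℂ] B :=
  dbar (almostAnalyticExt n ψ f) z • resolvent H z

/-- `f(H) = -(1/π) ∬ (∂f̃/∂z̄) (z - H)⁻¹ dx dy`, formed with the extension `f̃` of order `n`
and the cut-off `ψ`. -/
noncomputable def funCalc (n : ℕ) (ψ : ℝ → ℂ) (f : ℝ → ℂ) (H : B →ₗ.[ℂ] B) : B →L[ℂ] B :=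
  (-(1 / Real.pi : ℝ) : ℂ) • ∫ z : ℂ, integrand n ψ f H z

end HelfferSjostrand

/-! If the support of `f` stayed to the left of some `-ε < 0`, then `f̃` would live where the
resolvent is holomorphic. There `∂f̃/∂z̄ · (z - H)⁻¹` is the `∂/∂z̄` of the compactly supported C¹
function `f̃ · (z - H)⁻¹`, so its integral vanishes (`integral_integrand_eq_zero`).

In general the support may touch the spectrum at `0`. Replace `f` by its translates `f(· + t)`,
supported in `[-a - t, -t]`, and let `t ↓ 0`. Dominated convergence applies because `|∂f̃/∂z̄| ≤ C
|Im z|ⁿ` uniformly in `t ∈ [0, 1]` (`exists_norm_dbar_le`). Combined with the resolvent bound, this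
dominates the integrands by a multiple of `|Im z|^(n - 1 - α)` on a fixed box
(`exists_norm_integrand_le`), integrable since `n > α`. The case `t = 0` of the bound gives absolute
convergence. -/

namespace HelfferSjostrand

/-! ### Holomorphy of the resolvent of an unbounded operator. -/

section Resolvent

variable {B : Type*} [NormedAddCommGroup B] [NormedSpace ℂ B]

open Topology Filter

theorem resolvent_sub_resolvent {H : B →ₗ.[ℂ] B} {z w : ℂ} (hz : z ∈ resolventSet H)
    (hw : w ∈ resolventSet H) :
    resolvent H z - resolvent H w = (w - z) • (resolvent H z ∘L resolvent H w) := by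
  ext y
  obtain ⟨h, e⟩ := (isResolventAt_resolvent hw).1 y
  have key := (isResolventAt_resolvent hz).2 ⟨resolvent H w y, h⟩
  have e' : H ⟨resolvent H w y, h⟩ = w • resolvent H w y - y := by
    rw [eq_sub_iff_add_eq, ← eq_sub_iff_add_eq', e]
  simp only [e', map_sub, map_smul] at key
  simp only [sub_apply, smul_apply,
    ContinuousLinearMap.comp_apply]
  linear_combination (norm := module) key

/-- The resolvent identity bounds the difference by half of `‖resolvent H z‖`, which is absorbed on
the left. This local boundedness is what the proof of continuity needs. -/
theorem norm_resolvent_le_two_mul {H : B →ₗ.[ℂ] B} {z w : ℂ} (hz : z ∈ resolventSet H)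
    (hw : w ∈ resolventSet H) (hzw : ‖z - w‖ * ‖resolvent H w‖ ≤ 1 / 2) :
    ‖resolvent H z‖ ≤ 2 * ‖resolvent H w‖ := by
  have h1 : ‖resolvent H z - resolvent H w‖ ≤ ‖resolvent H z‖ * (1 / 2) := by
    rw [resolvent_sub_resolvent hz hw, norm_smul, norm_sub_rev]
    calc ‖z - w‖ * ‖resolvent H z ∘L resolvent H w‖
        ≤ ‖z - w‖ * (‖resolvent H z‖ * ‖resolvent H w‖) := by
          gcongr; exact ContinuousLinearMap.opNorm_comp_le _ _
      _ = ‖resolvent H z‖ * (‖z - w‖ * ‖resolvent H w‖) := by ring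
      _ ≤ _ := by gcongr
  have h2 := norm_sub_norm_le (resolvent H z) (resolvent H w)
  linarith

theorem continuousAt_resolvent {H : B →ₗ.[ℂ] B} {w : ℂ} (hw : resolventSet H ∈ 𝓝 w) :
    ContinuousAt (resolvent H) w := by
  have hw' := mem_of_mem_nhds hw
  have hlim (C : ℝ) : Tendsto (fun z : ℂ => ‖z - w‖ * C) (𝓝 w) (𝓝 0) := by
    have : Continuous fun z : ℂ => ‖z - w‖ * C := by fun_prop
    simpa using this.tendsto w
  rw [ContinuousAt, tendsto_iff_norm_sub_tendsto_zero]
  refine squeeze_zero' (.of_forall fun _ => norm_nonneg _) ?_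
    (hlim (2 * ‖resolvent H w‖ * ‖resolvent H w‖))
  filter_upwards [hw, (hlim ‖resolvent H w‖).eventually_le_const (by norm_num : (0 : ℝ) < 1 / 2)]
    with z hz hzw
  rw [resolvent_sub_resolvent hz hw', norm_smul, norm_sub_rev]
  gcongr
  refine (ContinuousLinearMap.opNorm_comp_le _ _).trans ?_
  gcongr
  exact norm_resolvent_le_two_mul hz hw' hzw

theorem differentiableAt_resolvent {H : B →ₗ.[ℂ] B} {w : ℂ} (hw : resolventSet H ∈ 𝓝 w) :
    DifferentiableAt ℂ (resolvent H) w := by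
  have hw' := mem_of_mem_nhds hw
  suffices h : HasDerivAt (resolvent H) (-(resolvent H w ∘L resolvent H w)) w from
    h.differentiableAt
  rw [hasDerivAt_iff_tendsto_slope]
  have hc : Tendsto (fun z => -(resolvent H z ∘L resolvent H w)) (𝓝[≠] w)
      (𝓝 (-(resolvent H w ∘L resolvent H w))) :=
    (((continuousAt_resolvent hw).clm_comp continuousAt_const).neg).tendsto.mono_left
      nhdsWithin_le_nhds
  -- By the resolvent identity the difference quotient equals `-(resolvent H z ∘L resolvent H w)`
  -- exactly, so continuity suffices.
  refine hc.congr' ?_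
  filter_upwards [nhdsWithin_le_nhds hw, self_mem_nhdsWithin] with z hz hne
  rw [slope_def_module, resolvent_sub_resolvent hz hw', smul_smul, ← neg_sub z w, mul_neg,
    inv_mul_cancel₀ (sub_ne_zero.2 hne), neg_smul, one_smul]

theorem SemiBounded.mem_resolventSet {H : B →ₗ.[ℂ] B} {c α : ℝ} (hH : SemiBounded H c α) {z : ℂ}
    (hz : z.im ≠ 0 ∨ z.re < 0) : z ∈ resolventSet H := by
  by_contra h
  obtain ⟨x, hx, rfl⟩ := hH.spectrum_subset h
  rcases hz with hz | hz
  · simp at hz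
  · exact (not_lt.2 hx) (by simpa using hz)

theorem SemiBounded.differentiableAt_resolvent {H : B →ₗ.[ℂ] B} {c α : ℝ}
    (hH : SemiBounded H c α) {z : ℂ} (hz : z.im ≠ 0 ∨ z.re < 0) :
    DifferentiableAt ℂ (resolvent H) z := by
  refine HelfferSjostrand.differentiableAt_resolvent ?_
  have ho : IsOpen {z : ℂ | z.im ≠ 0 ∨ z.re < 0} :=
    (isOpen_ne_fun Complex.continuous_im continuous_const).union
      (isOpen_lt Complex.continuous_re continuous_const)
  exact Filter.mem_of_superset (ho.mem_nhds hz) fun w hw => hH.mem_resolventSet hw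

end Resolvent

/-! ### The almost analytic extension and its `∂/∂z̄`. -/

section Extension

open Topology Filter

theorem one_le_bracket (z : ℂ) : 1 ≤ bracket z :=
  Real.one_le_sqrt.2 (by nlinarith [sq_nonneg ‖z‖])

theorem bracket_pos (z : ℂ) : 0 < bracket z := zero_lt_one.trans_le (one_le_bracket z)

theorem bracket_le (z : ℂ) : bracket z ≤ 1 + ‖z‖ := by
  rw [bracket, Real.sqrt_le_left (by positivity)]
  nlinarith [norm_nonneg z]

theorem bracket_ofReal (x : ℝ) : bracket (x : ℂ) = √(1 + x ^ 2) := by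
  simp [bracket]

theorem continuous_bracket : Continuous bracket := by
  unfold bracket
  fun_prop

theorem contDiff_bracket_ofReal : ContDiff ℝ ∞ fun x : ℝ => bracket (x : ℂ) := by
  simp only [bracket_ofReal]
  exact (contDiff_const.add (contDiff_id.pow 2)).sqrt fun x => by
    have := sq_nonneg x
    simp only [id]
    positivity

theorem hasDerivAt_bracket_ofReal (x : ℝ) :
    HasDerivAt (fun x : ℝ => bracket (x : ℂ)) (x / bracket (x : ℂ)) x := by
  simp only [bracket_ofReal]
  have h := (((hasDerivAt_id x).fun_pow 2).const_add 1).sqrt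
    (by have := sq_nonneg x; simp only [id]; positivity)
  refine h.congr_deriv ?_
  simp only [id, Nat.cast_ofNat, mul_one, Nat.add_one_sub_one, pow_one]
  rw [mul_div_mul_left _ _ two_ne_zero]

theorem contDiff_iteratedDeriv {f : ℝ → ℂ} (hf : ContDiff ℝ ∞ f) (r : ℕ) :
    ContDiff ℝ ∞ (iteratedDeriv r f) := by
  rw [iteratedDeriv_eq_iterate]
  exact hf.iterate_deriv r

theorem hasDerivAt_iteratedDeriv {f : ℝ → ℂ} (hf : ContDiff ℝ ∞ f) (r : ℕ) (x : ℝ) :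
    HasDerivAt (iteratedDeriv r f) (iteratedDeriv (r + 1) f x) x := by
  rw [iteratedDeriv_succ]
  exact ((contDiff_iteratedDeriv hf r).differentiable (by simp) x).hasDerivAt

theorem support_iteratedDeriv_subset (f : ℝ → ℂ) (r : ℕ) :
    Function.support (iteratedDeriv r f) ⊆ tsupport f := by
  induction r with
  | zero => simpa using subset_tsupport f
  | succ r ih =>
    rw [iteratedDeriv_succ]
    exact support_deriv_subset.trans (closure_minimal ih (isClosed_tsupport f))

/-- The Taylor polynomial `∑_{r ≤ n} f⁽ʳ⁾(x) (iy)ʳ / r!` of `f` at `x`, in an imaginary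
direction. -/
noncomputable def taylorSum (n : ℕ) (f : ℝ → ℂ) (x y : ℝ) : ℂ :=
  ∑ r ∈ Finset.range (n + 1), iteratedDeriv r f x * (Complex.I * (y : ℂ)) ^ r / (r.factorial : ℂ)

theorem almostAnalyticExt_eq (n : ℕ) (ψ f : ℝ → ℂ) (x y : ℝ) :
    almostAnalyticExt n ψ f x y = taylorSum n f x y * ψ (y / bracket (x : ℂ)) := rfl

theorem taylorSum_eq_zero {f : ℝ → ℂ} {x : ℝ} (hx : x ∉ tsupport f) (n : ℕ) (y : ℝ) :
    taylorSum n f x y = 0 := by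
  refine Finset.sum_eq_zero fun r _ => ?_
  have : iteratedDeriv r f x = 0 := by
    by_contra h
    exact hx (support_iteratedDeriv_subset f r h)
  simp [this]

theorem hasDerivAt_taylorSum_re {f : ℝ → ℂ} (hf : ContDiff ℝ ∞ f) (n : ℕ) (x y : ℝ) :
    HasDerivAt (fun x => taylorSum n f x y)
      (∑ r ∈ Finset.range (n + 1),
        iteratedDeriv (r + 1) f x * (Complex.I * (y : ℂ)) ^ r / (r.factorial : ℂ)) x := by
  unfold taylorSum
  exact HasDerivAt.fun_sum fun r _ =>
    ((hasDerivAt_iteratedDeriv hf r x).mul_const _).div_const _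

theorem hasDerivAt_taylorSum_im (f : ℝ → ℂ) (n : ℕ) (x y : ℝ) :
    HasDerivAt (fun y => taylorSum n f x y)
      (Complex.I * ∑ r ∈ Finset.range n,
        iteratedDeriv (r + 1) f x * (Complex.I * (y : ℂ)) ^ r / (r.factorial : ℂ)) y := by
  unfold taylorSum
  have h : ∀ r ∈ Finset.range (n + 1), HasDerivAt
      (fun y : ℝ => iteratedDeriv r f x * (Complex.I * (y : ℂ)) ^ r / (r.factorial : ℂ))
      (iteratedDeriv r f x * (r * (Complex.I * (y : ℂ)) ^ (r - 1) * (Complex.I * 1)) /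
        (r.factorial : ℂ)) y := fun r _ =>
    ((((hasDerivAt_id y).ofReal_comp.const_mul Complex.I).fun_pow r).const_mul _).div_const _
  refine (HasDerivAt.fun_sum h).congr_deriv ?_
  -- The `r = 0` term is constant in `y`; splitting it off shifts the index and removes the
  -- truncated `r - 1`.
  rw [Finset.sum_range_succ', Finset.mul_sum]
  simp only [Nat.cast_zero, zero_mul, mul_zero, zero_div, add_zero]
  refine Finset.sum_congr rfl fun r _ => ?_
  rw [Nat.factorial_succ, add_tsub_cancel_right]
  have h1 : (r.factorial : ℂ) ≠ 0 := by exact_mod_cast r.factorial_ne_zero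
  have h2 : ((r + 1 : ℕ) : ℂ) ≠ 0 := by exact_mod_cast r.succ_ne_zero
  rw [Nat.cast_mul]
  field_simp

/-- The `y`-derivative of the Taylor sum is `i` times its `x`-derivative without the top term. Since
`i² = -1`, only the term of order `n` survives where `ψ` is not differentiated. -/
theorem dbar_almostAnalyticExt {f ψ : ℝ → ℂ} (hf : ContDiff ℝ ∞ f) (hψ : ContDiff ℝ ∞ ψ) (n : ℕ)
    (z : ℂ) :
    dbar (almostAnalyticExt n ψ f) z = 1 / 2 *
      (iteratedDeriv (n + 1) f z.re * (Complex.I * (z.im : ℂ)) ^ n / (n.factorial : ℂ) *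
          ψ (z.im / bracket (z.re : ℂ)) +
        taylorSum n f z.re z.im * (deriv ψ (z.im / bracket (z.re : ℂ)) *
          (((-(z.im * z.re) / bracket (z.re : ℂ) ^ 3 : ℝ) : ℂ) +
            Complex.I * ((1 / bracket (z.re : ℂ) : ℝ) : ℂ)))) := by
  have hb := (bracket_pos (z.re : ℂ)).ne'
  have hψ' := (hψ.differentiable (by simp) (z.im / bracket (z.re : ℂ))).hasDerivAt
  have sx : HasDerivAt (fun x : ℝ => z.im / bracket (x : ℂ))
      (-(z.im * z.re) / bracket (z.re : ℂ) ^ 3) z.re := by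
    refine ((hasDerivAt_const z.re z.im).fun_div (hasDerivAt_bracket_ofReal z.re) hb).congr_deriv ?_
    field_simp
    ring
  have sy : HasDerivAt (fun y : ℝ => y / bracket (z.re : ℂ)) (1 / bracket (z.re : ℂ)) z.im :=
    (hasDerivAt_id z.im).div_const _
  have dx := (hasDerivAt_taylorSum_re hf n z.re z.im).mul (hψ'.scomp z.re sx)
  have dy := (hasDerivAt_taylorSum_im f n z.re z.im).mul (hψ'.scomp z.im sy)
  have ex := dx.deriv
  have ey := dy.deriv
  rw [dbar]
  change 1 / 2 * (deriv (_ * _) _ + Complex.I * deriv (_ * _) _) = _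
  erw [ex, ey]
  rw [Finset.sum_range_succ]
  simp only [Complex.real_smul, Function.comp]
  linear_combination (1 / 2 * (∑ r ∈ Finset.range n, iteratedDeriv (r + 1) f z.re *
    (Complex.I * (z.im : ℂ)) ^ r / (r.factorial : ℂ)) * ψ (z.im / bracket (z.re : ℂ))) *
      Complex.I_mul_I

theorem contDiff_almostAnalyticExt {f ψ : ℝ → ℂ} (hf : ContDiff ℝ ∞ f) (hψ : ContDiff ℝ ∞ ψ)
    (n : ℕ) : ContDiff ℝ ∞ fun z : ℂ => almostAnalyticExt n ψ f z.re z.im := by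
  have hre : ContDiff ℝ ∞ Complex.re := Complex.reCLM.contDiff
  have him : ContDiff ℝ ∞ Complex.im := Complex.imCLM.contDiff
  have hof : ContDiff ℝ ∞ fun z : ℂ => (z.im : ℂ) := Complex.ofRealCLM.contDiff.comp him
  unfold almostAnalyticExt
  refine (ContDiff.sum fun r _ => ?_).mul
    (hψ.comp (him.div (contDiff_bracket_ofReal.comp hre) fun z => (bracket_pos _).ne'))
  exact (((contDiff_iteratedDeriv hf r).comp hre).mul ((contDiff_const.mul hof).pow r)).div_const _

theorem dbar_eq_fderiv {F : ℝ → ℝ → ℂ} {z : ℂ}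
    (hF : DifferentiableAt ℝ (fun w : ℂ => F w.re w.im) z) :
    dbar F z = 1 / 2 * (fderiv ℝ (fun w : ℂ => F w.re w.im) z 1 +
      Complex.I * fderiv ℝ (fun w : ℂ => F w.re w.im) z Complex.I) := by
  have hx : HasDerivAt (fun x : ℝ => (x : ℂ) + z.im * Complex.I) 1 z.re :=
    (hasDerivAt_id z.re).ofReal_comp.add_const _
  have hy : HasDerivAt (fun y : ℝ => (z.re : ℂ) + y * Complex.I) Complex.I z.im := by
    simpa using ((hasDerivAt_id z.im).ofReal_comp.mul_const Complex.I).const_add (z.re : ℂ)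
  have dx := (HasFDerivAt.comp_hasDerivAt_of_eq z.re hF.hasFDerivAt hx
    (Complex.re_add_im z).symm).deriv
  have dy := (HasFDerivAt.comp_hasDerivAt_of_eq z.im hF.hasFDerivAt hy
    (Complex.re_add_im z).symm).deriv
  rw [dbar, ← dx, ← dy]
  simp [Function.comp_def]

end Extension

/-! ### Supports and bounds uniform in the translation. -/

section Bounds

open Topology Filter Set

theorem IsCutoff.deriv_eq_zero_of_lt_one {ψ : ℝ → ℂ} (hψ : IsCutoff ψ) {s : ℝ} (hs : |s| < 1) :
    deriv ψ s = 0 := by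
  have : ψ =ᶠ[𝓝 s] fun _ => 1 := by
    filter_upwards [(isOpen_lt continuous_abs continuous_const).mem_nhds hs] with u hu
    exact hψ.eq_one u (le_of_lt hu)
  rw [this.deriv_eq, deriv_const]

theorem IsCutoff.deriv_eq_zero_of_two_lt {ψ : ℝ → ℂ} (hψ : IsCutoff ψ) {s : ℝ} (hs : 2 < |s|) :
    deriv ψ s = 0 := by
  have : ψ =ᶠ[𝓝 s] fun _ => 0 := by
    filter_upwards [(isOpen_lt continuous_const continuous_abs).mem_nhds hs] with u hu
    exact hψ.eq_zero u (le_of_lt hu)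
  rw [this.deriv_eq, deriv_const]

/-- A closed square containing the support of the almost analytic extension of a function supported
in `[-b, 0]`. -/
def supportBox (b : ℝ) : Set ℂ := Icc (-(2 * (1 + |b|))) (2 * (1 + |b|)) ×ℂ
  Icc (-(2 * (1 + |b|))) (2 * (1 + |b|))

theorem isCompact_supportBox (b : ℝ) : IsCompact (supportBox b) :=
  isCompact_Icc.reProdIm isCompact_Icc

theorem mem_supportBox {b : ℝ} {z : ℂ} :
    z ∈ supportBox b ↔ |z.re| ≤ 2 * (1 + |b|) ∧ |z.im| ≤ 2 * (1 + |b|) := by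
  simp [supportBox, Complex.mem_reProdIm, abs_le]

/-- The strict inequality makes `deriv ψ` vanish along with `ψ`. The box works because `⟨x⟩ ≤ 1 +
|b|` on the support. -/
theorem notMem_tsupport_or_two_lt {f : ℝ → ℂ} {b : ℝ} (hf : tsupport f ⊆ Icc (-b) 0) {z : ℂ}
    (hz : z ∉ supportBox b) : z.re ∉ tsupport f ∨ 2 < |z.im / bracket (z.re : ℂ)| := by
  by_contra! h
  refine hz (mem_supportBox.2 ?_)
  obtain ⟨h1, h2⟩ := hf h.1
  have hre : |z.re| ≤ |b| := by
    rw [abs_le]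
    exact ⟨by linarith [le_abs_self b], h2.trans (abs_nonneg b)⟩
  have hbr := bracket_le (z.re : ℂ)
  rw [Complex.norm_real, Real.norm_eq_abs] at hbr
  have h3 := h.2
  rw [abs_div, abs_of_pos (bracket_pos _), div_le_iff₀ (bracket_pos _)] at h3
  constructor <;> linarith [abs_nonneg b]

theorem almostAnalyticExt_eq_zero {f ψ : ℝ → ℂ} {b : ℝ} (hψ : IsCutoff ψ)
    (hf : tsupport f ⊆ Icc (-b) 0) (n : ℕ) {z : ℂ} (hz : z ∉ supportBox b) :
    almostAnalyticExt n ψ f z.re z.im = 0 := by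
  rw [almostAnalyticExt_eq]
  rcases notMem_tsupport_or_two_lt hf hz with h | h
  · rw [taylorSum_eq_zero h, zero_mul]
  · rw [hψ.eq_zero _ h.le, mul_zero]

theorem dbar_almostAnalyticExt_eq_zero {f ψ : ℝ → ℂ} {b : ℝ} (hψ : IsCutoff ψ)
    (hf : ContDiff ℝ ∞ f) (hsupp : tsupport f ⊆ Icc (-b) 0) (n : ℕ) {z : ℂ}
    (hz : z ∉ supportBox b) : dbar (almostAnalyticExt n ψ f) z = 0 := by
  rw [dbar_almostAnalyticExt hf hψ.smooth]
  rcases notMem_tsupport_or_two_lt hsupp hz with h | h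
  · have : iteratedDeriv (n + 1) f z.re = 0 := by
      by_contra h'
      exact h (support_iteratedDeriv_subset f _ h')
    rw [taylorSum_eq_zero h, this]
    simp
  · rw [hψ.eq_zero _ h.le, hψ.deriv_eq_zero_of_two_lt h]
    simp

theorem tsupport_comp_add_subset {f : ℝ → ℂ} {a : ℝ} (hf : tsupport f ⊆ Icc (-a) 0) (t : ℝ) :
    tsupport (fun x => f (x + t)) ⊆ Icc (-a - t) (-t) := by
  refine closure_minimal (fun x hx => ?_) isClosed_Icc
  obtain ⟨h1, h2⟩ := hf (subset_tsupport f hx)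
  constructor <;> linarith

theorem tsupport_comp_add_subset_Icc_abs {f : ℝ → ℂ} {a : ℝ} (hf : tsupport f ⊆ Icc (-a) 0) {t : ℝ}
    (ht : t ∈ Icc (0 : ℝ) 1) : tsupport (fun x => f (x + t)) ⊆ Icc (-(|a| + 1)) 0 :=
  (tsupport_comp_add_subset hf t).trans
    (Icc_subset_Icc (by linarith [ht.2, le_abs_self a]) (by linarith [ht.1]))

theorem continuous_bracket_re : Continuous fun p : ℝ × ℂ => bracket (p.2.re : ℂ) := by
  have := continuous_bracket
  fun_prop

theorem continuous_cutoff_arg : Continuous fun p : ℝ × ℂ => p.2.im / bracket (p.2.re : ℂ) :=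
  (by fun_prop : Continuous fun p : ℝ × ℂ => p.2.im).div continuous_bracket_re
    fun _ => (bracket_pos _).ne'

/-- The part of `∂f̃/∂z̄` in which the cut-off is differentiated. -/
noncomputable def dbarCutoffPart (n : ℕ) (ψ f : ℝ → ℂ) (z : ℂ) : ℂ :=
  taylorSum n f z.re z.im * (deriv ψ (z.im / bracket (z.re : ℂ)) *
    (((-(z.im * z.re) / bracket (z.re : ℂ) ^ 3 : ℝ) : ℂ) +
      Complex.I * ((1 / bracket (z.re : ℂ) : ℝ) : ℂ)))

/-- Continuity is joint in the translation and `z`, so that compactness yields a constant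
independent of the translation. -/
theorem continuous_dbarCutoffPart {f ψ : ℝ → ℂ} (hf : ContDiff ℝ ∞ f) (hψ : ContDiff ℝ ∞ ψ)
    (n : ℕ) : Continuous fun p : ℝ × ℂ => dbarCutoffPart n ψ (fun x => f (x + p.1)) p.2 := by
  have hb := continuous_bracket_re
  have hb' (p : ℝ × ℂ) : bracket (p.2.re : ℂ) ≠ 0 := (bracket_pos _).ne'
  have hb3 (p : ℝ × ℂ) : bracket (p.2.re : ℂ) ^ 3 ≠ 0 := pow_ne_zero _ (hb' p)
  have hd : Continuous (deriv ψ) := hψ.continuous_deriv (by simp)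
  unfold dbarCutoffPart taylorSum
  simp only [iteratedDeriv_comp_add_const]
  refine Continuous.mul (continuous_finsetSum _ fun r _ => ?_)
    ((hd.comp continuous_cutoff_arg).mul (by fun_prop (disch := assumption)))
  have := (contDiff_iteratedDeriv hf r).continuous
  fun_prop

/-- The part of `∂f̃/∂z̄` in which the cut-off is not differentiated, divided by `(Im z)ⁿ`. -/
noncomputable def dbarTaylorPart (n : ℕ) (ψ f : ℝ → ℂ) (z : ℂ) : ℂ :=
  iteratedDeriv (n + 1) f z.re * Complex.I ^ n / (n.factorial : ℂ) *
    ψ (z.im / bracket (z.re : ℂ))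

theorem continuous_dbarTaylorPart {f ψ : ℝ → ℂ} (hf : ContDiff ℝ ∞ f) (hψ : ContDiff ℝ ∞ ψ)
    (n : ℕ) : Continuous fun p : ℝ × ℂ => dbarTaylorPart n ψ (fun x => f (x + p.1)) p.2 := by
  unfold dbarTaylorPart
  simp only [iteratedDeriv_comp_add_const]
  have := (contDiff_iteratedDeriv hf (n + 1)).continuous
  exact (by fun_prop : Continuous fun p : ℝ × ℂ => iteratedDeriv (n + 1) f (p.2.re + p.1) *
    Complex.I ^ n / (n.factorial : ℂ)).mul (hψ.continuous.comp continuous_cutoff_arg)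

theorem dbar_almostAnalyticExt_eq_add {f ψ : ℝ → ℂ} (hf : ContDiff ℝ ∞ f) (hψ : ContDiff ℝ ∞ ψ)
    (n : ℕ) (z : ℂ) : dbar (almostAnalyticExt n ψ f) z =
      1 / 2 * (dbarTaylorPart n ψ f z * (z.im : ℂ) ^ n + dbarCutoffPart n ψ f z) := by
  rw [dbar_almostAnalyticExt hf hψ, dbarTaylorPart, dbarCutoffPart]
  ring

theorem contDiff_comp_add {f : ℝ → ℂ} (hf : ContDiff ℝ ∞ f) (t : ℝ) :
    ContDiff ℝ ∞ fun x => f (x + t) :=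
  hf.comp (contDiff_id.add contDiff_const)

theorem continuous_dbar_almostAnalyticExt {f ψ : ℝ → ℂ} (hf : ContDiff ℝ ∞ f)
    (hψ : ContDiff ℝ ∞ ψ) (n : ℕ) :
    Continuous fun p : ℝ × ℂ => dbar (almostAnalyticExt n ψ fun x => f (x + p.1)) p.2 := by
  have h1 := continuous_dbarTaylorPart hf hψ n
  have h2 := continuous_dbarCutoffPart hf hψ n
  simp only [fun p : ℝ × ℂ => dbar_almostAnalyticExt_eq_add (contDiff_comp_add hf p.1) hψ n p.2]
  fun_prop

/-- The Taylor part carries the factor `(Im z)ⁿ` explicitly. The cut-off part vanishes for `|y| <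
⟨x⟩`; elsewhere `|y| ≥ ⟨x⟩ ≥ 1`, so a constant bound can be multiplied by `|y|ⁿ`. -/
theorem exists_norm_dbar_le {f ψ : ℝ → ℂ} {a : ℝ} (hψ : IsCutoff ψ) (hf : ContDiff ℝ ∞ f)
    (hsupp : tsupport f ⊆ Icc (-a) 0) (n : ℕ) :
    ∃ C, 0 ≤ C ∧ ∀ t ∈ Icc (0 : ℝ) 1, ∀ z : ℂ,
      ‖dbar (almostAnalyticExt n ψ fun x => f (x + t)) z‖ ≤
        (supportBox (|a| + 1)).indicator (fun z => C * |z.im| ^ n) z := by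
  have hK : IsCompact (Icc (0 : ℝ) 1 ×ˢ supportBox (|a| + 1)) :=
    isCompact_Icc.prod (isCompact_supportBox _)
  obtain ⟨C₁, h₁⟩ := hK.exists_bound_of_continuousOn
    (continuous_dbarTaylorPart hf hψ.smooth n).continuousOn
  obtain ⟨C₂, h₂⟩ := hK.exists_bound_of_continuousOn
    (continuous_dbarCutoffPart hf hψ.smooth n).continuousOn
  refine ⟨|C₁| + |C₂|, by positivity, fun t ht z => ?_⟩
  by_cases hz : z ∈ supportBox (|a| + 1)
  · rw [indicator_of_mem hz, dbar_almostAnalyticExt_eq_add (contDiff_comp_add hf t) hψ.smooth]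
    have hT : ‖dbarTaylorPart n ψ (fun x => f (x + t)) z * (z.im : ℂ) ^ n‖ ≤ |C₁| * |z.im| ^ n := by
      rw [norm_mul, norm_pow, Complex.norm_real, Real.norm_eq_abs]
      gcongr
      exact (h₁ (t, z) ⟨ht, hz⟩).trans (le_abs_self _)
    have hC : ‖dbarCutoffPart n ψ (fun x => f (x + t)) z‖ ≤ |C₂| * |z.im| ^ n := by
      by_cases hs : |z.im / bracket (z.re : ℂ)| < 1
      · rw [dbarCutoffPart, hψ.deriv_eq_zero_of_lt_one hs]
        simp only [zero_mul, mul_zero, norm_zero]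
        positivity
      · rw [abs_div, abs_of_pos (bracket_pos _), not_lt, one_le_div (bracket_pos _)] at hs
        refine ((h₂ (t, z) ⟨ht, hz⟩).trans (le_abs_self _)).trans ?_
        exact le_mul_of_one_le_right (abs_nonneg _)
          (one_le_pow₀ ((one_le_bracket _).trans hs))
    have hsum := (norm_add_le _ _).trans (add_le_add hT hC)
    rw [norm_mul, show ‖(1 / 2 : ℂ)‖ = 1 / 2 by norm_num]
    have := norm_nonneg
      (dbarTaylorPart n ψ (fun x => f (x + t)) z * (z.im : ℂ) ^ n +
        dbarCutoffPart n ψ (fun x => f (x + t)) z)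
    linarith
  · rw [indicator_of_notMem hz, dbar_almostAnalyticExt_eq_zero hψ (contDiff_comp_add hf t)
      (tsupport_comp_add_subset_Icc_abs hsupp ht) n hz, norm_zero]

theorem integrableOn_abs_rpow {p : ℝ} (hp : -1 < p) {L : ℝ} (hL : 0 ≤ L) :
    IntegrableOn (fun y : ℝ => |y| ^ p) (Icc (-L) L) := by
  have h : IntervalIntegrable (fun y : ℝ => |y| ^ p) volume 0 L := by
    refine (intervalIntegral.intervalIntegrable_rpow' hp).congr fun y hy => ?_
    rw [uIoc_of_le hL] at hy
    simp only [abs_of_pos hy.1]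
  have h' : IntervalIntegrable (fun y : ℝ => |y| ^ p) volume (-L) 0 := by
    simpa using ((IntervalIntegrable.iff_comp_neg (by simp)).1 h).symm
  exact (intervalIntegrable_iff_integrableOn_Icc_of_le (by linarith)).1 (h'.trans h)

theorem integrable_indicator_abs_im_rpow {p : ℝ} (hp : -1 < p) (b : ℝ) :
    Integrable ((supportBox b).indicator fun z : ℂ => |z.im| ^ p) := by
  have hL : 0 ≤ 2 * (1 + |b|) := by positivity
  have h1 : Integrable ((Icc (-(2 * (1 + |b|))) (2 * (1 + |b|))).indicator fun _ : ℝ => (1 : ℝ)) :=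
    (integrable_indicator_iff measurableSet_Icc).2 (by simp)
  have h2 := (integrable_indicator_iff measurableSet_Icc).2 (integrableOn_abs_rpow hp hL)
  have h3 := (Complex.volume_preserving_equiv_real_prod.integrable_comp_emb
    (MeasurableEquiv.measurableEmbedding _)).2 (h1.mul_prod h2)
  refine h3.congr (.of_forall fun z => ?_)
  simp only [Function.comp, Complex.measurableEquivRealProd_apply, supportBox, indicator,
    Complex.mem_reProdIm]
  by_cases h₁ : z.re ∈ Icc (-(2 * (1 + |b|))) (2 * (1 + |b|))
  · simp only [h₁, if_true, true_and, one_mul]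
    congr
  · simp only [h₁, if_false, false_and, zero_mul]

end Bounds

/-! ### Absolute convergence and vanishing of the integral. -/

section Integral

open Topology Filter Set

variable {B : Type*} [NormedAddCommGroup B] [NormedSpace ℂ B]

theorem exists_norm_integrand_le {H : B →ₗ.[ℂ] B} {c α : ℝ} (hα : 0 ≤ α) (hH : SemiBounded H c α)
    {f ψ : ℝ → ℂ} {a : ℝ} (hψ : IsCutoff ψ) (hf : ContDiff ℝ ∞ f)
    (hsupp : tsupport f ⊆ Icc (-a) 0) {n : ℕ} (hn : α < n) :
    ∃ C, ∀ t ∈ Icc (0 : ℝ) 1, ∀ z : ℂ, ‖integrand n ψ (fun x => f (x + t)) H z‖ ≤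
      C * (supportBox (|a| + 1)).indicator (fun z => |z.im| ^ ((n : ℝ) - 1 - α)) z := by
  obtain ⟨C, hC, h⟩ := exists_norm_dbar_le hψ hf hsupp n
  -- `M` bounds `bracket z ≤ 1 + |Re z| + |Im z|` on the box.
  set M : ℝ := 1 + 2 * (2 * (1 + |(|a| + 1)|))
  have hM : 0 ≤ M := by positivity
  refine ⟨C * (|c| * M ^ α), fun t ht z => ?_⟩
  rw [integrand, norm_smul]
  by_cases hz : z ∈ supportBox (|a| + 1)
  · have hd := h t ht z
    rw [indicator_of_mem hz] at hd ⊢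
    -- The resolvent estimate says nothing on the real axis, but there `n > α ≥ 0` forces the factor
    -- `∂f̃/∂z̄` to vanish.
    by_cases hy : z.im = 0
    · have hn0 : n ≠ 0 := by
        rintro rfl
        exact (hα.trans_lt hn).ne' (by simp)
      simp only [hy, abs_zero, zero_pow hn0, mul_zero] at hd
      rw [le_antisymm hd (norm_nonneg _), zero_mul]
      positivity
    · have hy' : 0 < |z.im| := abs_pos.2 hy
      have hbz : bracket z ≤ M := by
        have := mem_supportBox.1 hz
        have := bracket_le z
        have := Complex.norm_le_abs_re_add_abs_im z
        simp only [M]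
        linarith
      have hR : ‖resolvent H z‖ ≤ |c| * |z.im|⁻¹ * (M / |z.im|) ^ α := by
        refine (hH.norm_resolvent_le z hy).trans ?_
        have := (bracket_pos z).le
        gcongr
        exact le_abs_self c
      refine (mul_le_mul hd hR (norm_nonneg _) (by positivity)).trans_eq ?_
      rw [Real.div_rpow hM hy'.le, Real.rpow_sub hy', Real.rpow_sub hy', Real.rpow_natCast,
        Real.rpow_one]
      field_simp
  · have hd := h t ht z
    rw [indicator_of_notMem hz] at hd ⊢
    rw [le_antisymm hd (norm_nonneg _)]
    simp

/-- This reduces measurability to the open set `Im z ≠ 0`, where the integrand is continuous. -/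
theorem integrand_eq_zero_of_im_eq_zero {H : B →ₗ.[ℂ] B} {f ψ : ℝ → ℂ} {a : ℝ} (hψ : IsCutoff ψ)
    (hf : ContDiff ℝ ∞ f) (hsupp : tsupport f ⊆ Icc (-a) 0) {n : ℕ} (hn : n ≠ 0) {z : ℂ}
    (hz : z.im = 0) : integrand n ψ f H z = 0 := by
  obtain ⟨C, -, h⟩ := exists_norm_dbar_le hψ hf hsupp n
  have hd := h 0 (by simp) z
  simp only [add_zero] at hd
  have h0 : (supportBox (|a| + 1)).indicator (fun z : ℂ => C * |z.im| ^ n) z = 0 := by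
    simp [indicator, hz, hn]
  rw [h0] at hd
  rw [integrand, norm_le_zero_iff.1 hd, zero_smul]

theorem aestronglyMeasurable_integrand {H : B →ₗ.[ℂ] B} {c α : ℝ} (hH : SemiBounded H c α)
    {f ψ : ℝ → ℂ} {a : ℝ} (hψ : IsCutoff ψ) (hf : ContDiff ℝ ∞ f)
    (hsupp : tsupport f ⊆ Icc (-a) 0) {n : ℕ} (hn : n ≠ 0) :
    AEStronglyMeasurable (integrand n ψ f H) := by
  have hU : MeasurableSet {z : ℂ | z.im ≠ 0} :=
    (isOpen_ne_fun Complex.continuous_im continuous_const).measurableSet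
  have hind : integrand n ψ f H = {z : ℂ | z.im ≠ 0}.indicator (integrand n ψ f H) := by
    refine (indicator_eq_self.2 fun z hz => ?_).symm
    by_contra h
    exact hz (integrand_eq_zero_of_im_eq_zero hψ hf hsupp hn (by simpa using h))
  rw [hind, aestronglyMeasurable_indicator_iff hU]
  refine ContinuousOn.aestronglyMeasurable (ContinuousOn.fun_smul ?_ ?_) hU
  · have := (continuous_dbar_almostAnalyticExt hf hψ.smooth n).comp
      (by fun_prop : Continuous fun z : ℂ => ((0 : ℝ), z))
    simpa [Function.comp_def] using this.continuousOn
  · exact fun z hz => (hH.differentiableAt_resolvent (.inl hz)).continuousAt.continuousWithinAt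

/-- Integration by parts against the constant function `1`. -/
theorem integral_fderiv_eq_zero {E F : Type*} [NormedAddCommGroup E] [NormedSpace ℝ E]
    [FiniteDimensional ℝ E] [MeasurableSpace E] [BorelSpace E] {μ : Measure E} [μ.IsAddHaarMeasure]
    [NormedAddCommGroup F] [NormedSpace ℝ F] {G : E → F} (hG : ContDiff ℝ 1 G)
    (hc : HasCompactSupport G) (v : E) :
    Integrable (fun x => fderiv ℝ G x v) μ ∧ ∫ x, fderiv ℝ G x v ∂μ = 0 := by
  have hi : Integrable (fun x => fderiv ℝ G x v) μ :=
    ((hG.continuous_fderiv (by simp)).clm_apply continuous_const).integrable_of_hasCompactSupport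
      (hc.fderiv_apply ℝ v)
  refine ⟨hi, ?_⟩
  have := integral_smul_fderiv_eq_neg_fderiv_smul_of_integrable (𝕜 := ℝ) (μ := μ)
    (f := fun _ : E => (1 : ℝ)) (g := G) (v := v) (by simp) (by simpa using hi)
    (by simpa using hG.continuous.integrable_of_hasCompactSupport hc)
    (fun _ _ => differentiableAt_const _) (fun x _ => hG.differentiable (by simp) x)
  simpa using this

theorem integral_integrand_eq_zero [CompleteSpace B] {H : B →ₗ.[ℂ] B} {c α : ℝ}
    (hH : SemiBounded H c α) {f ψ : ℝ → ℂ} {b ε : ℝ} (hε : 0 < ε) (hψ : IsCutoff ψ)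
    (hf : ContDiff ℝ ∞ f) (hsupp : tsupport f ⊆ Icc (-b) (-ε)) (n : ℕ) :
    ∫ z : ℂ, integrand n ψ f H z = 0 := by
  set g : ℂ → ℂ := fun z => almostAnalyticExt n ψ f z.re z.im with hg_def
  have hg : ContDiff ℝ 1 g := (contDiff_almostAnalyticExt hf hψ.smooth n).of_le (by simp)
  have hgd : Differentiable ℝ g := hg.differentiable (by simp)
  -- The gap `ε` makes `g` vanish near every point of the closed right half-plane, which contains
  -- the spectrum.
  have hg0 (z : ℂ) (hz : 0 ≤ z.re) : g =ᶠ[𝓝 z] 0 := by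
    filter_upwards [(isOpen_lt continuous_const Complex.continuous_re).mem_nhds
      (show -ε < z.re by linarith)] with w hw
    have : w.re ∉ tsupport f := fun h => absurd (hsupp h).2 (not_le.2 hw)
    simp [hg_def, almostAnalyticExt_eq, taylorSum_eq_zero this]
  set G : ℂ → (B →L[ℂ] B) := fun z => g z • resolvent H z with hG_def
  have hG0 (z : ℂ) (hz : 0 ≤ z.re) : G =ᶠ[𝓝 z] 0 := by
    filter_upwards [hg0 z hz] with w hw
    simp [hG_def, hw]
  have hG : ContDiff ℝ 1 G := by
    refine contDiff_iff_contDiffAt.2 fun z => ?_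
    rcases lt_or_ge z.re 0 with hz | hz
    · have ho : IsOpen {z : ℂ | z.re < 0} := isOpen_lt Complex.continuous_re continuous_const
      -- Complex differentiability on an open set upgrades to C¹ by Cauchy's theory.
      have hR : ContDiffAt ℂ 1 (resolvent H) z :=
        (DifferentiableOn.contDiffOn (fun w hw =>
          (hH.differentiableAt_resolvent (.inr hw)).differentiableWithinAt) ho).contDiffAt
            (ho.mem_nhds hz)
      exact hg.contDiffAt.smul (hR.restrict_scalars ℝ)
    · exact contDiffAt_const.congr_of_eventuallyEq (hG0 z hz)
  have hGc : HasCompactSupport G :=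
    HasCompactSupport.intro (isCompact_supportBox b) fun z hz => by
      simp only [hG_def, hg_def]
      rw [almostAnalyticExt_eq_zero hψ
        (hsupp.trans (Icc_subset_Icc_right (by linarith))) n hz, zero_smul]
  have key (z : ℂ) : integrand n ψ f H z =
      (1 / 2 : ℂ) • (fderiv ℝ G z 1 + Complex.I • fderiv ℝ G z Complex.I) := by
    rw [integrand, dbar_eq_fderiv (hgd z)]
    change (1 / 2 * (fderiv ℝ g z 1 + Complex.I * fderiv ℝ g z Complex.I)) • resolvent H z = _
    rcases lt_or_ge z.re 0 with hz | hz
    · have hR := hH.differentiableAt_resolvent (.inr hz)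
      -- The Cauchy–Riemann equation: it cancels the terms where the resolvent is differentiated.
      have hI : fderiv ℂ (resolvent H) z Complex.I =
          Complex.I • fderiv ℂ (resolvent H) z 1 := by
        rw [← map_smul, smul_eq_mul, mul_one]
      have hGd : fderiv ℝ G z = g z • fderiv ℝ (resolvent H) z +
          (fderiv ℝ g z).smulRight (resolvent H z) :=
        fderiv_fun_smul (hgd z) (hR.restrictScalars ℝ)
      rw [hGd, hR.fderiv_restrictScalars ℝ]
      simp only [add_apply, smul_apply, ContinuousLinearMap.smulRight_apply,
        ContinuousLinearMap.coe_restrictScalars', hI]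
      have hII : Complex.I • g z • Complex.I • fderiv ℂ (resolvent H) z 1 =
          -(g z • fderiv ℂ (resolvent H) z 1) := by
        rw [smul_smul, smul_smul, ← neg_smul]
        congr 1
        linear_combination g z * Complex.I_mul_I
      rw [smul_add Complex.I, hII]
      module
    · rw [(hg0 z hz).fderiv_eq, (hG0 z hz).fderiv_eq]
      simp
  obtain ⟨i1, e1⟩ := integral_fderiv_eq_zero (μ := volume) hG hGc 1
  obtain ⟨i2, e2⟩ := integral_fderiv_eq_zero (μ := volume) hG hGc Complex.I
  simp only [key]
  rw [integral_smul, integral_add i1 (i2.fun_smul Complex.I), integral_smul, e1, e2]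
  simp

theorem integrable_integrand_and_funCalc_eq_zero [CompleteSpace B] {H : B →ₗ.[ℂ] B} {c α : ℝ}
    (hα : 0 ≤ α) (hH : SemiBounded H c α) {a : ℝ} {f : ℝ → ℂ} (hf : ContDiff ℝ ∞ f)
    (hsupp : tsupport f ⊆ Icc (-a) 0) {n : ℕ} (hn : α < n) {ψ : ℝ → ℂ} (hψ : IsCutoff ψ) :
    Integrable (integrand n ψ f H) ∧ funCalc n ψ f H = 0 := by
  have hn0 : n ≠ 0 := by
    rintro rfl
    exact (hα.trans_lt hn).ne' (by simp)
  obtain ⟨C, hC⟩ := exists_norm_integrand_le hα hH hψ hf hsupp hn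
  have hbound := (integrable_indicator_abs_im_rpow
    (by linarith : -1 < (n : ℝ) - 1 - α) (|a| + 1)).const_mul C
  have hmeas (t : ℝ) (ht : t ∈ Icc (0 : ℝ) 1) :
      AEStronglyMeasurable (integrand n ψ (fun x => f (x + t)) H) :=
    aestronglyMeasurable_integrand hH hψ (contDiff_comp_add hf t)
      (tsupport_comp_add_subset_Icc_abs hsupp ht) hn0
  -- Only `t > 0` opens a gap between the support and the spectrum, hence the one-sided limit.
  have hnear : ∀ᶠ t in 𝓝[>] (0 : ℝ), t ∈ Ioc (0 : ℝ) 1 := Ioc_mem_nhdsGT one_pos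
  have hlim : Tendsto (fun t => ∫ z, integrand n ψ (fun x => f (x + t)) H z) (𝓝[>] 0)
      (𝓝 (∫ z, integrand n ψ f H z)) := by
    refine tendsto_integral_filter_of_dominated_convergence _
      (hnear.mono fun t ht => hmeas t (Ioc_subset_Icc_self ht))
      (hnear.mono fun t ht => .of_forall (hC t (Ioc_subset_Icc_self ht))) hbound
      (.of_forall fun z => ?_)
    have hc := (continuous_dbar_almostAnalyticExt hf hψ.smooth n).comp
      (by fun_prop : Continuous fun t : ℝ => (t, z))
    have := (hc.tendsto 0).smul_const (resolvent H z)
    simp only [Function.comp, add_zero] at this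
    exact this.mono_left nhdsWithin_le_nhds
  have hzero : ∫ z, integrand n ψ f H z = 0 := by
    refine tendsto_nhds_unique (hlim.congr' (hnear.mono fun t ht => ?_)) tendsto_const_nhds
    refine integral_integrand_eq_zero hH ht.1 hψ (contDiff_comp_add hf t) (b := a + t) ?_ n
    exact (tsupport_comp_add_subset hsupp t).trans (Icc_subset_Icc_left (by linarith))
  refine ⟨hbound.mono' ?_ (.of_forall fun z => ?_), ?_⟩
  · simpa using hmeas 0 (by simp)
  · simpa using hC 0 (by simp) z
  · rw [funCalc, hzero, smul_zero]

end Integral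

end HelfferSjostrand

theorem mainTheorem3 {B : Type*} [NormedAddCommGroup B] [NormedSpace ℂ B] [CompleteSpace B]
    (H : B →ₗ.[ℂ] B) (c α : ℝ) (hα : 0 ≤ α) (hH : HelfferSjostrand.SemiBounded H c α)
    (a : ℝ) (f : ℝ → ℂ) (hf : ContDiff ℝ ∞ f) (hsupp : tsupport f ⊆ Set.Icc (-a) 0)
    (n : ℕ) (hn : α < n) (ψ : ℝ → ℂ) (hψ : HelfferSjostrand.IsCutoff ψ) :
    Integrable (HelfferSjostrand.integrand n ψ f H) ∧
      HelfferSjostrand.funCalc n ψ f H = 0 := by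
  exact HelfferSjostrand.integrable_integrand_and_funCalc_eq_zero hα hH hf hsupp hn hψ
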